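/- Let $n\ge 1$, let $\Omega\subset\mathbb R^n$ be a bounded domain (non-empty, open, connected), and let $T>0$, $2<p<\infty$ and $\varepsilon>0$. Put $\Omega_T=\Omega\times(0,T)$, $\alpha=\frac{p-2}{p+n}$, $\beta=\frac{n+2}{p+n}$, $$S_\varepsilon=\{x\in\mathbb R^n\setminus\Omega:\operatorname{dist}(x,\partial\Omega)\le\varepsilon\},\qquad \Gamma_\varepsilon=\big(S_\varepsilon\times[-\varepsilon^2,T]\big)\cup\big(\Omega\times[-\varepsilon^2,0]\big),$$ and let $F:\Gamma_\varepsilon\to\mathbb R$ be continuous. A function $u:\Omega_T\cup\Gamma_\varepsilon\to\mathbb R$ satisfies the dynamic programming principle (DPP) with boundary data $F$ if it is Borel measurable, $u=F$ on $\Gamma_\varepsilon$, and for all $(x,t)\in\Omega_T$ $$u(x,t)=\frac{\beta}{|B_\varepsilon(x)|}\int_{B_\varepsilon(x)}u(y,t-\varepsilon^2)\,dy+\alpha\sup_{|\sigma|=1}\frac{u(x+\varepsilon\sigma,t-\varepsilon^2)+u(x-\varepsilon\sigma,t-\varepsilon^2)}{2}.$$ A strategy $S$ is a sequence of Borel functions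 that assign to each history $(t_0,x_0,\dots,x_k)$, $k\ge 0$, a unit vector $\sigma=S(t_0,x_0,\dots,x_k)\in\mathbb R^n$. For a starting point $(x_0,t_0)$, let $\mathbb P_S^{(x_0,t_0)}$ be the probability measure on sequences of states $(x_k,t_k)_{k\ge0}$ started at $(x_0,t_0)$ under which, given $(x_0,t_0),\dots,(x_k,t_k)$, one has $t_{k+1}=t_k-\varepsilon^2$, and $x_{k+1}$ is with probability $\beta$ uniformly distributed on $B_\varepsilon(x_k)$ and with probability $\frac{\alpha}{2}$ each equal to $x_k+\varepsilon\sigma$ or $x_k-\varepsilon\sigma$, where $\sigma=S(t_0,x_0,\dots,x_k)$. Let $\tau$ be the first index $k\ge 0$ with $(x_k,t_k)\in\Gamma_\varepsilon$, and let the value of the game with payoff $F$ be $$u^\varepsilon(x_0,t_0)=\sup_S\mathbb E_S^{(x_0,t_0)}\big[F(x_\tau,t_\tau)\big].$$ If $u_\varepsilon$ satisfies the DPP with boundary data $F$, then $u_\varepsilon=u^\varepsilon$ on $\Omega_T\cup\Gamma_\varepsilon$. -/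

import Mathlib

open MeasureTheory ProbabilityTheory

namespace DominativeGame

noncomputable section

/-- Euclidean space `ℝⁿ`. -/
abbrev E (n : ℕ) : Type := EuclideanSpace ℝ (Fin n)

/-- A state of the game: a position in `ℝⁿ` together with a time. -/
abbrev State (n : ℕ) : Type := E n × ℝ

/-- `α = (p - 2) / (p + n)`. -/
def alpha (n : ℕ) (p : ℝ) : ℝ := (p - 2) / (p + n)

/-- `β = (n + 2) / (p + n)`. -/
def beta (n : ℕ) (p : ℝ) : ℝ := (n + 2) / (p + n)

/-- The space-time cylinder `Ω_T = Ω × (0, T)`. -/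
def cylinder {n : ℕ} (Ω : Set (E n)) (T : ℝ) : Set (State n) :=
  Ω ×ˢ Set.Ioo 0 T

/-- The outer boundary strip `S_ε = {x ∈ ℝⁿ \ Ω : dist(x, ∂Ω) ≤ ε}`. -/
def outerStrip {n : ℕ} (Ω : Set (E n)) (ε : ℝ) : Set (E n) :=
  {x | x ∉ Ω ∧ Metric.infDist x (frontier Ω) ≤ ε}

/-- The parabolic boundary strip `Γ_ε = (S_ε × [-ε², T]) ∪ (Ω × [-ε², 0])`. -/
def boundaryStrip {n : ℕ} (Ω : Set (E n)) (T ε : ℝ) : Set (State n) :=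
  outerStrip Ω ε ×ˢ Set.Icc (-ε ^ 2) T ∪ Ω ×ˢ Set.Icc (-ε ^ 2) 0

/-- The dynamic programming principle in `Ω_T` with boundary data `F` on `Γ_ε`. Only the values of
`u` on `Ω_T ∪ Γ_ε` and those of `F` on `Γ_ε` matter. -/
structure SatisfiesDPP {n : ℕ} (Ω : Set (E n)) (T p ε : ℝ) (F u : State n → ℝ) : Prop where
  borel : Measurable (fun z : ↥(cylinder Ω T ∪ boundaryStrip Ω T ε) => u z)
  interior : ∀ x t, (x, t) ∈ cylinder Ω T →
    u (x, t) = beta n p * (⨍ y in Metric.ball x ε, u (y, t - ε ^ 2))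
      + alpha n p * ⨆ σ : Metric.sphere (0 : E n) 1,
          (u (x + ε • (σ : E n), t - ε ^ 2) + u (x - ε • (σ : E n), t - ε ^ 2)) / 2
  boundary : ∀ z ∈ boundaryStrip Ω T ε, u z = F z

/-- A strategy: Borel functions `S(t₀, x₀, …, x_k)`, one for each `k`, with values in the unit
sphere. -/
structure Strategy (n : ℕ) where
  dir : (k : ℕ) → ℝ × (Finset.Iic k → E n) → Metric.sphere (0 : E n) 1
  measurable_dir : ∀ k, Measurable (dir k)

/-- The direction selected by `S` after the token positions `(x₀, t₀), …, (x_k, t_k)`. -/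
def Strategy.next {n : ℕ} (S : Strategy n) (k : ℕ) (h : Finset.Iic k → State n) : E n :=
  S.dir k ((h ⟨0, Finset.mem_Iic.2 (Nat.zero_le k)⟩).2, fun i => (h i).1)

/-- The law of the next state when the token is at `z = (x, t)` and the direction is `σ`: with
probability `β` uniform on `B_ε(x) × {t - ε²}`, and with probability `α / 2` each of
`(x ± ε σ, t - ε²)`. -/
def stepLaw {n : ℕ} (p ε : ℝ) (z : State n) (σ : E n) : Measure (State n) :=
  ENNReal.ofReal (beta n p) •
      (ProbabilityTheory.cond volume (Metric.ball z.1 ε)).map (fun y => (y, z.2 - ε ^ 2))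
    + ENNReal.ofReal (alpha n p / 2) • Measure.dirac (z.1 + ε • σ, z.2 - ε ^ 2)
    + ENNReal.ofReal (alpha n p / 2) • Measure.dirac (z.1 - ε • σ, z.2 - ε ^ 2)

theorem Strategy.measurable_next {n : ℕ} (S : Strategy n) (k : ℕ) : Measurable (S.next k) := by
  unfold Strategy.next
  refine measurable_subtype_coe.comp ((S.measurable_dir k).comp ?_)
  fun_prop

theorem measurable_stepLaw {n : ℕ} (p ε : ℝ) :
    Measurable (fun q : State n × E n => stepLaw p ε q.1 q.2) := by
  refine Measure.measurable_of_measurable_coe _ fun A hA => ?_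
  have hm : ∀ s : ℝ, Measurable (fun y : E n => (y, s)) := fun s => by fun_prop
  simp only [stepLaw, Measure.add_apply, Measure.smul_apply, smul_eq_mul]
  refine Measurable.add (Measurable.add (Measurable.const_mul ?_ _) (Measurable.const_mul ?_ _))
    (Measurable.const_mul ?_ _)
  · have hset : MeasurableSet {w : (State n × E n) × E n |
        dist w.2 w.1.1.1 < ε ∧ (w.2, w.1.1.2 - ε ^ 2) ∈ A} := by
      have h1 : Measurable (fun w : (State n × E n) × E n => dist w.2 w.1.1.1) := by fun_prop
      refine MeasurableSet.inter (measurableSet_lt h1 measurable_const) ?_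
      exact (show Measurable (fun w : (State n × E n) × E n => (w.2, w.1.1.2 - ε ^ 2)) by
        fun_prop) hA
    have := measurable_measure_prodMk_left (ν := (volume : Measure (E n))) hset
    convert this.const_mul (volume (Metric.ball (0 : E n) ε))⁻¹ using 1
    funext q
    rw [Measure.map_apply (hm _) hA, cond_apply Metric.isOpen_ball.measurableSet,
      Measure.addHaar_ball_center]
    rfl
  · exact (Measure.measurable_coe hA).comp (Measure.measurable_dirac.comp (by fun_prop))
  · exact (Measure.measurable_coe hA).comp (Measure.measurable_dirac.comp (by fun_prop))

theorem isProbabilityMeasure_stepLaw {n : ℕ} {p ε : ℝ} (hp : 2 < p) (hε : 0 < ε)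
    (z : State n) (σ : E n) : IsProbabilityMeasure (stepLaw p ε z σ) := by
  have hn : (0 : ℝ) ≤ n := Nat.cast_nonneg n
  have hpos : 0 < p + n := by linarith
  have ha : 0 ≤ alpha n p / 2 := by unfold alpha; have := sub_pos.2 hp; positivity
  have hb : 0 ≤ beta n p := by unfold beta; positivity
  have : IsProbabilityMeasure (ProbabilityTheory.cond (volume : Measure (E n)) (Metric.ball z.1 ε)) :=
    cond_isProbabilityMeasure_of_finite (Metric.measure_ball_pos _ _ hε).ne'
      measure_ball_lt_top.ne
  have : IsProbabilityMeasure ((ProbabilityTheory.cond (volume : Measure (E n)) (Metric.ball z.1 ε)).map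
      (fun y => (y, z.2 - ε ^ 2))) :=
    Measure.isProbabilityMeasure_map (by fun_prop)
  refine ⟨?_⟩
  simp only [stepLaw, Measure.add_apply, Measure.smul_apply, smul_eq_mul, measure_univ, mul_one]
  rw [← ENNReal.ofReal_add hb ha, ← ENNReal.ofReal_add (by positivity) ha]
  rw [ENNReal.ofReal_eq_one]
  unfold alpha beta
  field_simp
  ring

theorem measurable_last_next {n : ℕ} (S : Strategy n) (k : ℕ) :
    Measurable (fun h : Finset.Iic k → State n =>
      (h ⟨k, Finset.mem_Iic.2 le_rfl⟩, S.next k h)) :=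
  (measurable_pi_apply (⟨k, Finset.mem_Iic.2 le_rfl⟩ : Finset.Iic k)).prodMk
    (S.measurable_next k)

theorem measurable_transition {n : ℕ} (p ε : ℝ) (S : Strategy n) (k : ℕ) :
    Measurable (fun h : Finset.Iic k → State n =>
      stepLaw p ε (h ⟨k, Finset.mem_Iic.2 le_rfl⟩) (S.next k h)) := by
  have h : Measurable ((fun q : State n × E n => stepLaw p ε q.1 q.2) ∘
      (fun h : Finset.Iic k → State n => (h ⟨k, Finset.mem_Iic.2 le_rfl⟩, S.next k h))) :=
    Measurable.comp (measurable_stepLaw p ε) (measurable_last_next S k)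
  exact h

/-- The transition probability `π_S((x₀, t₀), …, (x_k, t_k), ·)`. -/
def transition {n : ℕ} (p ε : ℝ) (S : Strategy n) (k : ℕ) :
    Kernel (Finset.Iic k → State n) (State n) where
  toFun h := stepLaw p ε (h ⟨k, Finset.mem_Iic.2 le_rfl⟩) (S.next k h)
  measurable' := measurable_transition p ε S k

theorem isMarkovKernel_transition {n : ℕ} {p ε : ℝ} (hp : 2 < p) (hε : 0 < ε)
    (S : Strategy n) (k : ℕ) : IsMarkovKernel (transition p ε S k) :=
  ⟨fun _ => isProbabilityMeasure_stepLaw hp hε _ _⟩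

/-- The law `ℙ_S^{z₀}` of the game sequence started at `z₀ = (x₀, t₀)`: the probability measure on
infinite sequences of states generated by the transition probabilities. -/
def gameLaw {n : ℕ} {p ε : ℝ} (hp : 2 < p) (hε : 0 < ε) (S : Strategy n) (z₀ : State n) :
    Measure (ℕ → State n) :=
  haveI := isMarkovKernel_transition hp hε S
  Kernel.traj (X := fun _ => State n) (transition p ε S) 0 (fun _ => z₀)

/-- The first index `τ` at which the game sequence lies in `Γ_ε` (with the convention `0` on the
sequences that never do; for a start in `Ω_T ∪ Γ_ε` they form a null set). -/
def hitIndex {n : ℕ} (Ω : Set (E n)) (T ε : ℝ) (ω : ℕ → State n) : ℕ :=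
  sInf {k | ω k ∈ boundaryStrip Ω T ε}

/-- The expected payoff `𝔼_S^{z₀}[F(x_τ, t_τ)]`. -/
def expectedPayoff {n : ℕ} (Ω : Set (E n)) (T : ℝ) {p ε : ℝ} (hp : 2 < p) (hε : 0 < ε)
    (F : State n → ℝ) (S : Strategy n) (z₀ : State n) : ℝ :=
  ∫ ω, F (ω (hitIndex Ω T ε ω)) ∂(gameLaw hp hε S z₀)

/-- The value of the game, `u^ε(z₀) = sup_S 𝔼_S^{z₀}[F(x_τ, t_τ)]`. -/
def gameValue {n : ℕ} (Ω : Set (E n)) (T : ℝ) {p ε : ℝ} (hp : 2 < p) (hε : 0 < ε)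
    (F : State n → ℝ) (z₀ : State n) : ℝ :=
  ⨆ S : Strategy n, expectedPayoff Ω T hp hε F S z₀

end

end DominativeGame

/-! Extend `u` by zero outside `Ω_T ∪ Γ_ε`. One move from `Ω_T` never leaves `Ω_T ∪ Γ_ε`, so the
extension still satisfies the DPP, and `α + β = 1` makes it bounded by the maximum of `|F|` on the
compact set `Γ_ε`. Time drops by `ε²` at each move, so from `(x₀, t₀)` the game ends after at most
`N` moves once `t₀ ≤ N ε²`.

Upper bound: for a fixed direction, the expectation of `u` after one move is at most the DPP
right-hand side. Hence `u` along the game, stopped on leaving `Ω_T`, is a supermartingale under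
every strategy (`integral_stoppedAlong_le`); after `N` moves it equals the payoff
(`stoppedAlong_eq_payoff`).

Lower bound: a strategy that attains the supremum up to `δ` at each move loses at most `N δ` in
total (`le_integral_stoppedAlong`), and `δ` is arbitrary. The difficulty is to choose such
directions in a Borel way, since for a merely Borel `u` near-maximizers need not be Borel. The DPP
supplies the missing regularity: every time slice of `u` has σ-compact strict superlevel sets
(`SatisfiesDPP.hasSigmaCompactSuperlevels_extend`). This passes from one slice to the next, because
the ball average is continuous and a supremum over the sphere corresponds to projecting a σ-compact
set. σ-compact sets have Borel selectors, which yields `exists_measurable_near_maximizer`. -/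

namespace DominativeGame

/-! ### σ-compact superlevel sets and Borel selection. -/

section SigmaCompact

variable {X Y : Type*} [TopologicalSpace X] [TopologicalSpace Y]

theorem isSigmaCompact_inter [T2Space X] {s t : Set X} (hs : IsSigmaCompact s)
    (ht : IsSigmaCompact t) : IsSigmaCompact (s ∩ t) := by
  obtain ⟨K, hK, rfl⟩ := hs
  obtain ⟨L, hL, rfl⟩ := ht
  rw [Set.iUnion_inter_iUnion, ← Set.iUnion_prod' (fun ij : ℕ × ℕ => K ij.1 ∩ L ij.2)]
  exact isSigmaCompact_iUnion_of_isCompact (fun ij : ℕ × ℕ => K ij.1 ∩ L ij.2)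
    fun ij => (hK ij.1).inter (hL ij.2)

theorem isSigmaCompact_union {s t : Set X} (hs : IsSigmaCompact s)
    (ht : IsSigmaCompact t) : IsSigmaCompact (s ∪ t) := by
  rw [Set.union_eq_iUnion]
  exact isSigmaCompact_iUnion _ fun b => by cases b <;> assumption

theorem isSigmaCompact_of_isClosed [SigmaCompactSpace X] {s : Set X} (hs : IsClosed s) :
    IsSigmaCompact s :=
  isSigmaCompact_univ.of_isClosed_subset hs (Set.subset_univ s)

theorem isSigmaCompact_of_isOpen {X : Type*} [MetricSpace X] [SigmaCompactSpace X] {s : Set X}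
    (hs : IsOpen s) : IsSigmaCompact s := by
  obtain ⟨K, hK, -, hU, -⟩ := hs.exists_iUnion_isClosed
  rw [← hU]
  exact isSigmaCompact_iUnion _ fun i => isSigmaCompact_of_isClosed (hK i)

theorem isSigmaCompact_preimage [SigmaCompactSpace X] [T2Space Y] {s : Set Y}
    (hs : IsSigmaCompact s) {f : X → Y} (hf : Continuous f) : IsSigmaCompact (f ⁻¹' s) := by
  obtain ⟨K, hK, rfl⟩ := hs
  rw [Set.preimage_iUnion]
  exact isSigmaCompact_iUnion _ fun i => isSigmaCompact_of_isClosed ((hK i).isClosed.preimage hf)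

theorem measurableSet_of_isSigmaCompact [T2Space X] [MeasurableSpace X]
    [OpensMeasurableSpace X] {s : Set X} (hs : IsSigmaCompact s) : MeasurableSet s := by
  obtain ⟨K, hK, rfl⟩ := hs
  exact MeasurableSet.iUnion fun i => (hK i).isClosed.measurableSet

/-- A real function all of whose strict superlevel sets are σ-compact. Unlike Borel measurability,
this is inherited by the supremum over a compact parameter. -/
def HasSigmaCompactSuperlevels (f : X → ℝ) : Prop :=
  ∀ c : ℝ, IsSigmaCompact {x | c < f x}

namespace HasSigmaCompactSuperlevels

theorem of_continuous {X : Type*} [MetricSpace X] [SigmaCompactSpace X] {f : X → ℝ}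
    (hf : Continuous f) : HasSigmaCompactSuperlevels f :=
  fun _ => isSigmaCompact_of_isOpen (isOpen_lt continuous_const hf)

theorem congr {f g : X → ℝ} (hf : HasSigmaCompactSuperlevels f) (h : ∀ x, g x = f x) :
    HasSigmaCompactSuperlevels g := by
  rwa [funext h]

theorem comp [SigmaCompactSpace X] [T2Space Y] {f : Y → ℝ} (hf : HasSigmaCompactSuperlevels f)
    {g : X → Y} (hg : Continuous g) : HasSigmaCompactSuperlevels (fun x => f (g x)) :=
  fun c => isSigmaCompact_preimage (hf c) hg

theorem add [T2Space X] {f g : X → ℝ} (hf : HasSigmaCompactSuperlevels f)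
    (hg : HasSigmaCompactSuperlevels g) : HasSigmaCompactSuperlevels (fun x => f x + g x) := by
  intro c
  have : {x | c < f x + g x} = ⋃ q : ℚ, {x | (q : ℝ) < f x} ∩ {x | c - q < g x} := by
    ext x
    simp only [Set.mem_ofPred_eq, Set.mem_iUnion, Set.mem_inter_iff]
    constructor
    · intro h
      obtain ⟨q, hq1, hq2⟩ := exists_rat_btwn (show c - g x < f x by linarith)
      exact ⟨q, hq2, by linarith⟩
    · rintro ⟨q, h1, h2⟩
      linarith
  rw [this]
  exact isSigmaCompact_iUnion _ fun q => isSigmaCompact_inter (hf _) (hg _)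

theorem const_mul {f : X → ℝ} (hf : HasSigmaCompactSuperlevels f) {a : ℝ} (ha : 0 < a) :
    HasSigmaCompactSuperlevels (fun x => a * f x) := by
  intro c
  have : {x | c < a * f x} = {x | c / a < f x} := by
    ext x
    simp only [Set.mem_ofPred_eq]
    rw [div_lt_iff₀' ha]
  rw [this]
  exact hf _

theorem measurable [T2Space X] [MeasurableSpace X] [OpensMeasurableSpace X] {f : X → ℝ}
    (hf : HasSigmaCompactSuperlevels f) : Measurable f :=
  measurable_of_Ioi fun c => measurableSet_of_isSigmaCompact (hf c)

/-- A supremum exceeds `c` exactly when some value does, so its superlevel set is a projection, and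
continuous images of σ-compact sets are σ-compact. For Borel sets this step would fail. -/
theorem iSup [Nonempty Y] {f : X × Y → ℝ}
    (hf : HasSigmaCompactSuperlevels f) (hb : ∀ x, BddAbove (Set.range fun y => f (x, y))) :
    HasSigmaCompactSuperlevels (fun x => ⨆ y, f (x, y)) := by
  intro c
  have : {x | c < ⨆ y, f (x, y)} = Prod.fst '' {q | c < f q} := by
    ext x
    simp [lt_ciSup_iff (hb x)]
  rw [this]
  exact (hf c).image continuous_fst

end HasSigmaCompactSuperlevels

/-- A compact set has a Borel selector: it contains the graph of a Borel map over its
projection. -/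
theorem exists_measurable_selector_of_isCompact {X Y : Type*} [TopologicalSpace X] [T2Space X]
    [MeasurableSpace X] [OpensMeasurableSpace X] [MetricSpace Y] [CompactSpace Y] [Nonempty Y]
    [MeasurableSpace Y] [BorelSpace Y] {K : Set (X × Y)} (hK : IsCompact K) :
    ∃ s : X → Y, Measurable s ∧ ∀ x ∈ Prod.fst '' K, (x, s x) ∈ K := by
  classical
  -- A compact metric space is a continuous image of the Cantor set. Pulling `K` back there puts the
  -- fibres inside `ℝ`, where the least element is a canonical choice.
  obtain ⟨φ, hφ, hφs⟩ := exists_nat_bool_continuous_surjective_of_compact Y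
  let ψ : cantorSet → Y := φ ∘ cantorSetHomeomorphNatToBool
  have hψ : Continuous ψ := hφ.comp cantorSetHomeomorphNatToBool.continuous
  have hψs : Function.Surjective ψ := hφs.comp cantorSetHomeomorphNatToBool.surjective
  have : CompactSpace cantorSet := isCompact_iff_compactSpace.1 isCompact_cantorSet
  let C : Set (X × cantorSet) := {q | (q.1, ψ q.2) ∈ K}
  have hCc : IsCompact C := by
    have hcl : IsClosed C := hK.isClosed.preimage (by fun_prop)
    refine ((hK.image continuous_fst).prod (isCompact_univ (X := cantorSet))).of_isClosed_subset
      hcl ?_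
    rintro ⟨x, c⟩ h
    exact ⟨⟨_, h, rfl⟩, trivial⟩
  have hmin : ∀ x ∈ Prod.fst '' K, ∃ c : cantorSet, (x, c) ∈ C ∧
      ∀ d, (x, d) ∈ C → (c : ℝ) ≤ d := by
    rintro x ⟨⟨x', y⟩, hxy, rfl⟩
    obtain ⟨c, rfl⟩ := hψs y
    have hcomp : IsCompact {d : cantorSet | (x', d) ∈ C} := by
      refine IsClosed.isCompact ?_
      exact hCc.isClosed.preimage (by fun_prop)
    obtain ⟨m, hm, hm'⟩ := hcomp.exists_isMinOn ⟨c, hxy⟩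
      (continuous_subtype_val.continuousOn)
    exact ⟨m, hm, fun d hd => hm' hd⟩
  let z : cantorSet := ⟨0, zero_mem_cantorSet⟩
  have : Nonempty cantorSet := ⟨z⟩
  choose! h hC hle using hmin
  let g : X → cantorSet := fun x => if x ∈ Prod.fst '' K then h x else z
  have hPm : MeasurableSet (Prod.fst '' K) := (hK.image continuous_fst).isClosed.measurableSet
  have hg : Measurable g := by
    refine Measurable.subtype_mk (p := (· ∈ cantorSet)) (f := fun x => (g x : ℝ)) ?_
      (h := fun x => (g x).2)
    refine measurable_of_Iic fun r => ?_
    have hm1 : MeasurableSet (Prod.fst '' (C ∩ {q | (q.2 : ℝ) ≤ r})) := by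
      refine ((hCc.inter_right ?_).image continuous_fst).isClosed.measurableSet
      exact isClosed_le (by fun_prop) continuous_const
    -- The least point of a fibre is at most `r` iff some point of the fibre is, so over the
    -- projection of `K` the sublevel set is the projection of a compact set. Elsewhere `g` takes
    -- the default value `0`.
    have : (fun x => (g x : ℝ)) ⁻¹' Set.Iic r =
        (Prod.fst '' (C ∩ {q | (q.2 : ℝ) ≤ r})) ∪
          ((Prod.fst '' K)ᶜ ∩ {_x | (0 : ℝ) ≤ r}) := by
      ext x
      by_cases hx : x ∈ Prod.fst '' K
      · simp only [Set.mem_preimage, Set.mem_Iic, g, if_true, Set.mem_union, Set.mem_inter_iff,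
          Set.mem_compl_iff, hx, not_true, false_and, or_false]
        constructor
        · intro hr
          exact ⟨(x, h x), ⟨hC x hx, hr⟩, rfl⟩
        · rintro ⟨⟨x', d⟩, ⟨h1, h2⟩, rfl⟩
          exact (hle _ hx d h1).trans h2
      · have hne : x ∉ Prod.fst '' (C ∩ {q | (q.2 : ℝ) ≤ r}) := by
          rintro ⟨⟨x', d⟩, ⟨h1, h2⟩, rfl⟩
          exact hx ⟨_, h1, rfl⟩
        simp only [Set.mem_preimage, Set.mem_Iic, g, if_false, Set.mem_union, hne, false_or,
          Set.mem_inter_iff, Set.mem_compl_iff, hx, not_false_eq_true, true_and, Set.mem_ofPred_eq,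
          z]
    rw [this]
    exact hm1.union (hPm.compl.inter (MeasurableSet.const _))
  refine ⟨fun x => ψ (g x), hψ.measurable.comp hg, fun x hx => ?_⟩
  have : (x, ψ (h x)) ∈ K := hC x hx
  simpa only [g, if_pos hx] using this

/-- A σ-compact set has a Borel selector. -/
theorem exists_measurable_selector_of_isSigmaCompact {X Y : Type*} [TopologicalSpace X]
    [T2Space X] [MeasurableSpace X] [OpensMeasurableSpace X] [MetricSpace Y] [CompactSpace Y]
    [Nonempty Y] [MeasurableSpace Y] [BorelSpace Y] {W : Set (X × Y)} (hW : IsSigmaCompact W) :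
    ∃ s : X → Y, Measurable s ∧ ∀ x ∈ Prod.fst '' W, (x, s x) ∈ W := by
  classical
  obtain ⟨K, hK, rfl⟩ := hW
  choose s hs hsK using fun i => exists_measurable_selector_of_isCompact (hK i)
  have hPm : ∀ i, MeasurableSet (Prod.fst '' K i) := fun i =>
    ((hK i).image continuous_fst).isClosed.measurableSet
  -- The second alternative only makes `Nat.find` total; over the projection it returns the first
  -- piece whose projection contains `x`.
  have hex : ∀ x, ∃ i, x ∈ Prod.fst '' K i ∨ x ∉ Prod.fst '' ⋃ j, K j := by
    intro x
    by_cases hx : x ∈ Prod.fst '' ⋃ j, K j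
    · rw [Set.image_iUnion] at hx
      obtain ⟨i, hi⟩ := Set.mem_iUnion.1 hx
      exact ⟨i, Or.inl hi⟩
    · exact ⟨0, Or.inr hx⟩
  have hfind : Measurable fun x => Nat.find (hex x) := by
    refine measurable_find hex fun i => (hPm i).union ?_
    rw [Set.image_iUnion]
    exact (MeasurableSet.iUnion hPm).compl
  refine ⟨fun x => s (Nat.find (hex x)) x, ?_, fun x hx => ?_⟩
  · have : Measurable (fun q : ℕ × X => s q.1 q.2) := measurable_from_prod_countable_right hs
    exact this.comp (hfind.prodMk measurable_id)
  · have := Nat.find_spec (hex x)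
    exact Set.mem_iUnion.2 ⟨_, hsK _ x (this.resolve_right (not_not.2 hx))⟩

/-- Borel near-maximizers over a compact parameter. -/
theorem exists_measurable_near_maximizer {X Y : Type*} [TopologicalSpace X]
    [T2Space X] [MeasurableSpace X] [OpensMeasurableSpace X] [MetricSpace Y] [CompactSpace Y]
    [Nonempty Y] [MeasurableSpace Y] [BorelSpace Y] {f : X × Y → ℝ}
    (hf : HasSigmaCompactSuperlevels f) (hb : ∀ x, BddAbove (Set.range fun y => f (x, y)))
    {δ : ℝ} (hδ : 0 < δ) :
    ∃ s : X → Y, Measurable s ∧ ∀ x, (⨆ y, f (x, y)) - δ ≤ f (x, s x) := by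
  choose s hs hsW using fun j : ℤ =>
    exists_measurable_selector_of_isSigmaCompact (hf (j * δ))
  let G : X → ℝ := fun x => ⨆ y, f (x, y)
  have hG : Measurable G := (hf.iSup hb).measurable
  -- The grid level with `j δ < G ≤ (j + 1) δ`. The strict lower bound makes the fibre of the
  -- superlevel set at `j δ` nonempty, and any point in it is within `δ` of the supremum.
  let j : X → ℤ := fun x => ⌈G x / δ⌉ - 1
  have hj : Measurable j := (Int.measurable_ceil.comp (hG.div_const δ)).sub_const 1
  refine ⟨fun x => s (j x) x, ?_, fun x => ?_⟩
  · have : Measurable (fun q : ℤ × X => s q.1 q.2) := measurable_from_prod_countable_right hs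
    exact this.comp (hj.prodMk measurable_id)
  · have h1 : (j x : ℝ) * δ < G x := by
      rw [← lt_div_iff₀ hδ]
      have := Int.ceil_lt_add_one (G x / δ)
      simp only [j]
      push_cast
      linarith
    have h2 : G x ≤ ((j x : ℝ) + 1) * δ := by
      rw [← div_le_iff₀ hδ]
      have := Int.le_ceil (G x / δ)
      simp only [j]
      push_cast
      linarith
    obtain ⟨y, hy⟩ := (lt_ciSup_iff (hb x)).1 h1
    have h3 : (j x : ℝ) * δ < f (x, s (j x) x) := hsW (j x) x ⟨(x, y), hy, rfl⟩
    change G x - δ ≤ _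
    linarith

end SigmaCompact

/-! ### Geometry of the strip: compactness, and where a move can land. -/

section Geometry

variable {n : ℕ} {Ω : Set (E n)} {T ε : ℝ}

theorem frontier_nonempty (hn : 1 ≤ n) (hΩ : Ω.Nonempty) (hb : Bornology.IsBounded Ω) :
    (frontier Ω).Nonempty := by
  have : Nonempty (Fin n) := ⟨⟨0, hn⟩⟩
  refine nonempty_frontier_iff.2 ⟨hΩ, ?_⟩
  rintro rfl
  exact NormedSpace.unbounded_univ ℝ (E n) hb

theorem exists_mem_frontier_segment {x y : E n} (ho : IsOpen Ω) (hx : x ∈ Ω) (hy : y ∉ Ω) :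
    ∃ w ∈ frontier Ω, w ∈ segment ℝ x y := by
  by_contra! h
  have hpre : IsPreconnected (segment ℝ x y) := (convex_segment x y).isPreconnected
  have hsub : segment ℝ x y ⊆ Ω ∪ (closure Ω)ᶜ := by
    intro w hw
    by_cases hwΩ : w ∈ Ω
    · exact Or.inl hwΩ
    · refine Or.inr fun hc => h w ?_ hw
      rw [ho.frontier_eq]
      exact ⟨hc, hwΩ⟩
  have := hpre.subset_left_of_subset_union ho isClosed_closure.isOpen_compl
    (Set.disjoint_compl_right_iff_subset.2 subset_closure) hsub ⟨x, left_mem_segment ℝ x y, hx⟩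
  exact hy (this (right_mem_segment ℝ x y))

/-- The segment from `x` to `y` meets `∂Ω`, so `y` is no farther from `∂Ω` than from `x`: a move
cannot jump over the strip. -/
theorem mem_outerStrip_of_dist_le {x y : E n} (ho : IsOpen Ω) (hx : x ∈ Ω) (hy : y ∉ Ω)
    (hd : dist y x ≤ ε) : y ∈ outerStrip Ω ε := by
  refine ⟨hy, ?_⟩
  obtain ⟨w, hw, hws⟩ := exists_mem_frontier_segment ho hx hy
  refine (Metric.infDist_le_dist_of_mem hw).trans (le_trans ?_ hd)
  have := dist_add_dist_of_mem_segment hws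
  have h0 : 0 ≤ dist x w := dist_nonneg
  rw [dist_comm y w, dist_comm y x]
  linarith

theorem isClosed_outerStrip (ho : IsOpen Ω) : IsClosed (outerStrip Ω ε) :=
  ho.isClosed_compl.inter (isClosed_le (Metric.continuous_infDist_pt _) continuous_const)

theorem isClosed_union_outerStrip (ho : IsOpen Ω) (hε : 0 < ε) :
    IsClosed (Ω ∪ outerStrip Ω ε) := by
  have : Ω ∪ outerStrip Ω ε = closure Ω ∪ outerStrip Ω ε := by
    refine Set.Subset.antisymm (Set.union_subset_union_left _ subset_closure)
      (Set.union_subset ?_ Set.subset_union_right)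
    intro x hx
    by_cases hxΩ : x ∈ Ω
    · exact Or.inl hxΩ
    · refine Or.inr ⟨hxΩ, ?_⟩
      rw [Metric.infDist_zero_of_mem]
      · exact hε.le
      · rw [ho.frontier_eq]
        exact ⟨hx, hxΩ⟩
  rw [this]
  exact isClosed_closure.union (isClosed_outerStrip ho)

theorem isBounded_union_outerStrip (hn : 1 ≤ n) (hΩ : Ω.Nonempty)
    (hb : Bornology.IsBounded Ω) : Bornology.IsBounded (Ω ∪ outerStrip Ω ε) := by
  refine hb.union ?_
  refine (hb.closure.cthickening (δ := ε)).subset ?_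
  rintro x ⟨-, hx⟩
  have hf := frontier_nonempty hn hΩ hb
  obtain ⟨w, hw, hwd⟩ := isClosed_frontier.exists_infDist_eq_dist hf x
  exact Metric.mem_cthickening_of_dist_le x w ε _ (frontier_subset_closure hw) (hwd ▸ hx)

/-- `Ω × [-ε², 0]` is not closed; adding the part of the strip at times up to `0`, already in `Γ_ε`,
makes both factors closed. -/
theorem boundaryStrip_eq (hT : 0 < T) : boundaryStrip Ω T ε =
    outerStrip Ω ε ×ˢ Set.Icc (-ε ^ 2) T ∪ (Ω ∪ outerStrip Ω ε) ×ˢ Set.Icc (-ε ^ 2) 0 := by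
  ext ⟨x, t⟩
  simp only [boundaryStrip, Set.mem_union, Set.mem_prod, Set.mem_Icc]
  constructor
  · tauto
  · rintro (h | ⟨h | h, h1, h2⟩)
    · exact Or.inl h
    · exact Or.inr ⟨h, h1, h2⟩
    · exact Or.inl ⟨h, h1, h2.trans hT.le⟩

theorem isCompact_boundaryStrip (hn : 1 ≤ n) (ho : IsOpen Ω) (hΩ : Ω.Nonempty)
    (hb : Bornology.IsBounded Ω) (hT : 0 < T) (hε : 0 < ε) :
    IsCompact (boundaryStrip Ω T ε) := by
  rw [boundaryStrip_eq hT]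
  have hX : IsCompact (Ω ∪ outerStrip Ω ε) :=
    Metric.isCompact_of_isClosed_isBounded (isClosed_union_outerStrip ho hε)
      (isBounded_union_outerStrip hn hΩ hb)
  exact ((hX.of_isClosed_subset (isClosed_outerStrip ho) Set.subset_union_right).prod
    isCompact_Icc).union (hX.prod isCompact_Icc)

theorem isOpen_cylinder (ho : IsOpen Ω) : IsOpen (cylinder Ω T) := ho.prod isOpen_Ioo

theorem mem_domain_of_dist_le {x y : E n} {t : ℝ} (ho : IsOpen Ω)
    (hxt : (x, t) ∈ cylinder Ω T) (hd : dist y x ≤ ε) :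
    (y, t - ε ^ 2) ∈ cylinder Ω T ∪ boundaryStrip Ω T ε := by
  obtain ⟨hx, ht0, htT⟩ := hxt
  simp only at hx ht0 htT
  have hε2 := sq_nonneg ε
  by_cases hy : y ∈ Ω
  · rcases lt_or_ge 0 (t - ε ^ 2) with h | h
    · exact Or.inl ⟨hy, h, by simp only; linarith⟩
    · exact Or.inr (Or.inr ⟨hy, by simp only; linarith, h⟩)
  · exact Or.inr (Or.inl ⟨mem_outerStrip_of_dist_le ho hx hy hd,
      by simp only; linarith, by simp only; linarith⟩)

theorem notMem_boundaryStrip {z : State n} (hz : z ∈ cylinder Ω T) :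
    z ∉ boundaryStrip Ω T ε := by
  rintro (h | h)
  · exact h.1.1 hz.1
  · exact absurd h.2.2 (not_le.2 hz.2.1)

end Geometry

/-! ### Ball averages and the one-step expectation. -/

section Average

variable {n : ℕ}

theorem alpha_pos {p : ℝ} (hp : 2 < p) : 0 < alpha n p := by
  have hn : (0 : ℝ) ≤ n := Nat.cast_nonneg n
  exact div_pos (by linarith) (by linarith)

theorem beta_pos {p : ℝ} (hp : 2 < p) : 0 < beta n p := by
  have hn : (0 : ℝ) ≤ n := Nat.cast_nonneg n
  exact div_pos (by linarith) (by linarith)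

theorem alpha_add_beta {p : ℝ} (hp : 2 < p) : alpha n p + beta n p = 1 := by
  have hn : (0 : ℝ) ≤ n := Nat.cast_nonneg n
  have : p + n ≠ 0 := by linarith
  unfold alpha beta
  field_simp
  ring

theorem abs_setAverage_ball_le {w : E n → ℝ} {M ε : ℝ} (hε : 0 < ε) (x : E n)
    (hw : ∀ y ∈ Metric.ball x ε, |w y| ≤ M) : |⨍ y in Metric.ball x ε, w y| ≤ M := by
  rw [setAverage_eq, smul_eq_mul, abs_mul, abs_of_nonneg (by positivity)]
  have hpos : 0 < volume.real (Metric.ball x ε) :=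
    ENNReal.toReal_pos (Metric.measure_ball_pos _ _ hε).ne' measure_ball_lt_top.ne
  have h := norm_setIntegral_le_of_norm_le_const (μ := volume) (s := Metric.ball x ε)
    (f := w) measure_ball_lt_top hw
  rw [Real.norm_eq_abs] at h
  rw [inv_mul_le_iff₀ hpos]
  linarith

/-- Dominated convergence: as the centre tends to `x₀`, the ball indicators converge off the sphere
of radius `ε` around `x₀`, a null set. Averaging thus turns a bounded Borel function into a
continuous one. -/
theorem continuous_setAverage_ball {w : E n → ℝ} {M ε : ℝ} (hε : 0 < ε) (hw : Measurable w)
    (hM : ∀ y, |w y| ≤ M) : Continuous fun x => ⨍ y in Metric.ball x ε, w y := by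
  have hvol : ∀ x : E n, volume.real (Metric.ball x ε) = volume.real (Metric.ball (0 : E n) ε) :=
    fun x => by simp [Measure.real, Measure.addHaar_ball_center]
  simp only [setAverage_eq, hvol, smul_eq_mul]
  refine continuous_const.mul ?_
  have hind : ∀ x : E n, ∫ y in Metric.ball x ε, w y = ∫ y, (Metric.ball x ε).indicator w y :=
    fun x => (integral_indicator Metric.isOpen_ball.measurableSet).symm
  simp only [hind]
  refine continuous_iff_continuousAt.2 fun x₀ => ?_
  refine continuousAt_of_dominated
    (bound := (Metric.ball x₀ (ε + 1)).indicator fun _ => M) ?_ ?_ ?_ ?_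
  · exact .of_forall fun x =>
      (hw.indicator Metric.isOpen_ball.measurableSet).aestronglyMeasurable
  · filter_upwards [Metric.ball_mem_nhds x₀ one_pos] with x hx
    refine .of_forall fun y => ?_
    have hM0 : 0 ≤ M := (abs_nonneg _).trans (hM y)
    by_cases hy : y ∈ Metric.ball x ε
    · have : y ∈ Metric.ball x₀ (ε + 1) := by
        rw [Metric.mem_ball] at *
        linarith [dist_triangle y x x₀]
      simp only [Set.indicator_of_mem hy, Set.indicator_of_mem this]
      exact hM y
    · rw [Set.indicator_of_notMem hy, norm_zero]
      exact Set.indicator_nonneg (fun _ _ => hM0) _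
  · exact (integrable_indicator_iff Metric.isOpen_ball.measurableSet).2
      (integrableOn_const measure_ball_lt_top.ne)
  · have hs : ∀ᵐ y ∂(volume : Measure (E n)), y ∉ Metric.sphere x₀ ε :=
      measure_eq_zero_iff_ae_notMem.1 (Measure.addHaar_sphere_of_ne_zero _ _ hε.ne')
    filter_upwards [hs] with y hy
    have hcont : Continuous fun x : E n => dist y x := by fun_prop
    rcases lt_or_gt_of_ne hy with h | h
    · refine (continuousAt_const (y := w y)).congr ?_
      filter_upwards [hcont.continuousAt.eventually_lt continuousAt_const h] with x hx
      exact (Set.indicator_of_mem (Metric.mem_ball.2 hx) _).symm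
    · refine (continuousAt_const (y := (0 : ℝ))).congr ?_
      filter_upwards [continuousAt_const.eventually_lt hcont.continuousAt h] with x hx
      exact (Set.indicator_of_notMem (fun h' => (not_lt.2 hx.le) (Metric.mem_ball.1 h')) _).symm

theorem integral_stepLaw {p ε M : ℝ} (hp : 2 < p) (hε : 0 < ε) {v : State n → ℝ}
    (hv : Measurable v) (hM : ∀ z, |v z| ≤ M) (z : State n) (σ : E n) :
    ∫ y, v y ∂(stepLaw p ε z σ) =
      beta n p * (⨍ y in Metric.ball z.1 ε, v (y, z.2 - ε ^ 2)) +
        alpha n p * ((v (z.1 + ε • σ, z.2 - ε ^ 2) + v (z.1 - ε • σ, z.2 - ε ^ 2)) / 2) := by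
  have := isProbabilityMeasure_stepLaw hp hε z σ
  have hint : Integrable v (stepLaw p ε z σ) :=
    Integrable.of_bound hv.aestronglyMeasurable M (.of_forall hM)
  unfold stepLaw at hint ⊢
  have h12 := hint.left_of_add_measure
  rw [integral_add_measure h12 hint.right_of_add_measure,
    integral_add_measure h12.left_of_add_measure h12.right_of_add_measure,
    integral_smul_measure, integral_smul_measure, integral_smul_measure, integral_dirac,
    integral_dirac, integral_map (by fun_prop) hv.aestronglyMeasurable, setAverage_eq',
    ENNReal.toReal_ofReal (beta_pos hp).le, ENNReal.toReal_ofReal (by linarith [alpha_pos (n := n) hp])]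
  simp only [ProbabilityTheory.cond, smul_eq_mul]
  ring

end Average

/-! ### Superlevel sets of functions glued from pieces. -/

section Superlevels

variable {X : Type*} [MetricSpace X] [SigmaCompactSpace X]

theorem HasSigmaCompactSuperlevels.piecewise {A : Set X} [DecidablePred (· ∈ A)] {f g : X → ℝ}
    (hA : IsOpen A)
    (hf : HasSigmaCompactSuperlevels f) (hg : HasSigmaCompactSuperlevels g) :
    HasSigmaCompactSuperlevels (A.piecewise f g) := by
  intro c
  have : {x | c < A.piecewise f g x} = A ∩ {x | c < f x} ∪ Aᶜ ∩ {x | c < g x} := by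
    ext x
    by_cases hx : x ∈ A <;> simp [hx]
  rw [this]
  exact isSigmaCompact_union (isSigmaCompact_inter (isSigmaCompact_of_isOpen hA) (hf c))
    (isSigmaCompact_inter (isSigmaCompact_of_isClosed hA.isClosed_compl) (hg c))

theorem HasSigmaCompactSuperlevels.indicator_of_continuousOn {A : Set X} {f : X → ℝ}
    (hA : IsClosed A) (hf : ContinuousOn f A) :
    HasSigmaCompactSuperlevels (A.indicator f) := by
  intro c
  have : SigmaCompactSpace A :=
    isSigmaCompact_iff_sigmaCompactSpace.1 (isSigmaCompact_of_isClosed hA)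
  have hs : {x | c < A.indicator f x} =
      (Subtype.val '' {x : A | c < A.domRestrict f x}) ∪ Aᶜ ∩ {_x | c < 0} := by
    ext x
    by_cases hx : x ∈ A <;> simp [hx]
  rw [hs]
  refine isSigmaCompact_union ?_ ?_
  · exact (HasSigmaCompactSuperlevels.of_continuous
      (continuousOn_iff_continuous_domRestrict.1 hf) c).image continuous_subtype_val
  · refine isSigmaCompact_inter (isSigmaCompact_of_isOpen hA.isOpen_compl) ?_
    exact isSigmaCompact_of_isOpen isOpen_const

end Superlevels

/-! ### Consequences of the DPP: boundedness, regularity of time slices, near-optimal directions. -/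

section DPP

variable {n : ℕ} {Ω : Set (E n)} {T p ε : ℝ} {F u : State n → ℝ}

/-- The domain `Ω_T ∪ Γ_ε` on which the game is played. -/
abbrev domain (Ω : Set (E n)) (T ε : ℝ) : Set (State n) := cylinder Ω T ∪ boundaryStrip Ω T ε

theorem nonempty_sphere (hn : 1 ≤ n) : Nonempty (Metric.sphere (0 : E n) 1) := by
  have : Nonempty (Fin n) := ⟨⟨0, hn⟩⟩
  exact (NormedSpace.sphere_nonempty.2 zero_le_one).to_subtype

theorem abs_ciSup_le {ι : Type*} [Nonempty ι] {f : ι → ℝ} {M : ℝ} (h : ∀ i, |f i| ≤ M) :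
    |⨆ i, f i| ≤ M := by
  have hb : BddAbove (Set.range f) := ⟨M, by rintro _ ⟨i, rfl⟩; exact (abs_le.1 (h i)).2⟩
  refine abs_le.2 ⟨?_, ciSup_le fun i => (abs_le.1 (h i)).2⟩
  obtain ⟨i⟩ := ‹Nonempty ι›
  exact (abs_le.1 (h i)).1.trans (le_ciSup hb i)

theorem dist_add_smul_le (hε : 0 < ε) (x : E n) (σ : Metric.sphere (0 : E n) 1) :
    dist (x + ε • (σ : E n)) x ≤ ε := by
  have : ‖(σ : E n)‖ = 1 := norm_eq_of_mem_sphere σ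
  simp [dist_eq_norm, norm_smul, this, abs_of_pos hε]

theorem dist_sub_smul_le (hε : 0 < ε) (x : E n) (σ : Metric.sphere (0 : E n) 1) :
    dist (x - ε • (σ : E n)) x ≤ ε := by
  have : ‖(σ : E n)‖ = 1 := norm_eq_of_mem_sphere σ
  simp [norm_smul, this, abs_of_pos hε]

theorem SatisfiesDPP.exists_bound (hu : SatisfiesDPP Ω T p ε F u) (hn : 1 ≤ n) (ho : IsOpen Ω)
    (hΩ : Ω.Nonempty) (hb : Bornology.IsBounded Ω) (hT : 0 < T) (hp : 2 < p) (hε : 0 < ε)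
    (hF : ContinuousOn F (boundaryStrip Ω T ε)) : ∃ M, ∀ z ∈ domain Ω T ε, |u z| ≤ M := by
  have := nonempty_sphere hn
  obtain ⟨M, hM⟩ := (isCompact_boundaryStrip hn ho hΩ hb hT hε).exists_bound_of_continuousOn hF
  refine ⟨M, ?_⟩
  -- Induction over time layers of height `ε²`; at nonpositive times `u` is given by `F`.
  have hind : ∀ k : ℕ, ∀ z ∈ domain Ω T ε, z.2 ≤ k * ε ^ 2 → |u z| ≤ M := by
    intro k
    induction k with
    | zero =>
      rintro z (hz | hz) hk
      · have := hz.2.1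
        simp only [Nat.cast_zero, zero_mul] at hk
        linarith
      · rw [hu.boundary z hz]
        exact hM z hz
    | succ k ih =>
      rintro ⟨x, t⟩ (hz | hz) hk
      · have hnext : ∀ y, dist y x ≤ ε → |u (y, t - ε ^ 2)| ≤ M := fun y hy =>
          ih _ (mem_domain_of_dist_le ho hz hy) (by push_cast at hk; simp only at hk ⊢; linarith)
        have h1 := abs_setAverage_ball_le hε x (w := fun y => u (y, t - ε ^ 2))
          fun y hy => hnext y (Metric.mem_ball.1 hy).le
        have h2 := abs_ciSup_le (M := M) (f := fun σ : Metric.sphere (0 : E n) 1 =>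
          (u (x + ε • (σ : E n), t - ε ^ 2) + u (x - ε • (σ : E n), t - ε ^ 2)) / 2) fun σ => by
            have ha := abs_le.1 (hnext _ (dist_add_smul_le hε x σ))
            have hb := abs_le.1 (hnext _ (dist_sub_smul_le hε x σ))
            exact abs_le.2 ⟨by linarith [ha.1, hb.1], by linarith [ha.2, hb.2]⟩
        rw [hu.interior x t hz]
        have hα := alpha_pos (n := n) hp
        have hβ := beta_pos (n := n) hp
        have hM1 : M = beta n p * M + alpha n p * M := by
          rw [← add_mul, add_comm, alpha_add_beta hp, one_mul]
        rw [hM1]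
        refine (abs_add_le _ _).trans ?_
        rw [abs_mul, abs_mul, abs_of_pos hα, abs_of_pos hβ]
        gcongr
      · rw [hu.boundary _ hz]
        exact hM _ hz
  intro z hz
  obtain ⟨k, hk⟩ := exists_nat_ge (z.2 / ε ^ 2)
  exact hind k z hz ((div_le_iff₀ (by positivity)).1 hk)

/-- Extension of `u` by zero outside `Ω_T ∪ Γ_ε`. -/
noncomputable def extend (Ω : Set (E n)) (T ε : ℝ) (u : State n → ℝ) : State n → ℝ :=
  (domain Ω T ε).indicator u

theorem extend_of_mem {z : State n} (hz : z ∈ domain Ω T ε) : extend Ω T ε u z = u z :=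
  Set.indicator_of_mem hz u

theorem abs_extend_le {M : ℝ} (hn : Ω.Nonempty) (hT : 0 < T)
    (hM : ∀ z ∈ domain Ω T ε, |u z| ≤ M) (z : State n) :
    |extend Ω T ε u z| ≤ M := by
  by_cases hz : z ∈ domain Ω T ε
  · rw [extend_of_mem hz]
    exact hM z hz
  · rw [extend, Set.indicator_of_notMem hz, abs_zero]
    -- A point of the cylinder is exhibited only to see that `M` is nonnegative.
    obtain ⟨x, hx⟩ := hn
    exact (abs_nonneg _).trans
      (hM (x, T / 2) (Or.inl ⟨hx, by simp only; linarith, by simp only; linarith⟩))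

theorem SatisfiesDPP.measurable_extend (hu : SatisfiesDPP Ω T p ε F u)
    (hD : MeasurableSet (domain Ω T ε)) : Measurable (extend Ω T ε u) := by
  refine measurable_of_restrict_of_restrict_compl hD ?_ ?_
  · convert! hu.borel using 1
    funext z
    exact extend_of_mem z.2
  · convert! (measurable_const : Measurable fun _ : ↥(domain Ω T ε)ᶜ => (0 : ℝ)) using 1
    funext z
    exact Set.indicator_of_notMem z.2 u

theorem SatisfiesDPP.extend_interior (hu : SatisfiesDPP Ω T p ε F u) (ho : IsOpen Ω)
    (hε : 0 < ε) {x : E n} {t : ℝ} (hz : (x, t) ∈ cylinder Ω T) :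
    extend Ω T ε u (x, t) =
      beta n p * (⨍ y in Metric.ball x ε, extend Ω T ε u (y, t - ε ^ 2))
      + alpha n p * ⨆ σ : Metric.sphere (0 : E n) 1,
          (extend Ω T ε u (x + ε • (σ : E n), t - ε ^ 2) +
            extend Ω T ε u (x - ε • (σ : E n), t - ε ^ 2)) / 2 := by
  have hnext : ∀ y, dist y x ≤ ε → extend Ω T ε u (y, t - ε ^ 2) = u (y, t - ε ^ 2) :=
    fun y hy => extend_of_mem (mem_domain_of_dist_le ho hz hy)
  rw [extend_of_mem (Or.inl hz), hu.interior x t hz]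
  congr 2
  · exact setAverage_congr_fun Metric.isOpen_ball.measurableSet
      (.of_forall fun y hy => (hnext y (Metric.mem_ball.1 hy).le).symm)
  · exact iSup_congr fun σ => by
      rw [hnext _ (dist_add_smul_le hε x σ), hnext _ (dist_sub_smul_le hε x σ)]

/-- The mean of `g` at the two endpoints `x ± ε σ`. -/
noncomputable def endpointMean (ε : ℝ) (g : E n → ℝ) (q : E n × Metric.sphere (0 : E n) 1) : ℝ :=
  (g (q.1 + ε • (q.2 : E n)) + g (q.1 - ε • (q.2 : E n))) / 2

theorem HasSigmaCompactSuperlevels.endpointMean {g : E n → ℝ}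
    (hg : HasSigmaCompactSuperlevels g) :
    HasSigmaCompactSuperlevels (endpointMean ε g) := by
  have h1 := hg.comp (X := E n × Metric.sphere (0 : E n) 1)
    (g := fun q => q.1 + ε • (q.2 : E n)) (by fun_prop)
  have h2 := hg.comp (X := E n × Metric.sphere (0 : E n) 1)
    (g := fun q => q.1 - ε • (q.2 : E n)) (by fun_prop)
  have h3 := (h1.add h2).const_mul (a := 1 / 2) (by norm_num)
  convert h3 using 2 with q
  unfold DominativeGame.endpointMean
  ring

theorem bddAbove_endpointMean {g : E n → ℝ} {M : ℝ} (hM : ∀ y, |g y| ≤ M) (x : E n) :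
    BddAbove (Set.range fun σ => endpointMean ε g (x, σ)) := by
  refine ⟨M, ?_⟩
  rintro _ ⟨σ, rfl⟩
  have h1 := (abs_le.1 (hM (x + ε • (σ : E n)))).2
  have h2 := (abs_le.1 (hM (x - ε • (σ : E n)))).2
  simp only [endpointMean]
  linarith

/-- Induction on time layers. Outside `Ω_T` a slice is `F` on a closed set and zero elsewhere, or
zero throughout. Over `Ω` with `0 < s < T` it is a continuous average plus a positive multiple of a
supremum of means of the previous slice. Borel measurability of `u` enters only through the average.
-/
theorem SatisfiesDPP.hasSigmaCompactSuperlevels_extend (hu : SatisfiesDPP Ω T p ε F u)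
    (hn : 1 ≤ n) (ho : IsOpen Ω) (hT : 0 < T) (hp : 2 < p) (hε : 0 < ε)
    (hF : ContinuousOn F (boundaryStrip Ω T ε))
    (hm : Measurable (extend Ω T ε u)) {M : ℝ} (hM : ∀ z, |extend Ω T ε u z| ≤ M) (s : ℝ) :
    HasSigmaCompactSuperlevels fun x => extend Ω T ε u (x, s) := by
  classical
  have := nonempty_sphere hn
  have hε2 : 0 < ε ^ 2 := by positivity
  have hzero : HasSigmaCompactSuperlevels fun _ : E n => (0 : ℝ) := .of_continuous continuous_const
  have hind : ∀ k : ℕ, ∀ s : ℝ, s ≤ k * ε ^ 2 →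
      HasSigmaCompactSuperlevels fun x => extend Ω T ε u (x, s) := by
    intro k
    induction k with
    | zero =>
      intro s hs
      simp only [Nat.cast_zero, zero_mul] at hs
      have hcyl : ∀ x, (x, s) ∉ cylinder Ω T := fun x h => absurd h.2.1 (not_lt.2 hs)
      by_cases hs' : -ε ^ 2 ≤ s
      · have hmem : ∀ x, (x, s) ∈ boundaryStrip Ω T ε ↔ x ∈ Ω ∪ outerStrip Ω ε := by
          intro x
          rw [boundaryStrip_eq hT]
          simp only [Set.mem_union, Set.mem_prod, Set.mem_Icc]
          have : s ≤ T := hs.trans hT.le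
          tauto
        have h := HasSigmaCompactSuperlevels.indicator_of_continuousOn (f := fun x => F (x, s))
          (isClosed_union_outerStrip (Ω := Ω) ho hε)
          (hF.comp (by fun_prop) fun x hx => (hmem x).2 hx)
        refine HasSigmaCompactSuperlevels.congr h fun x => ?_
        by_cases hx : x ∈ Ω ∪ outerStrip Ω ε
        · rw [Set.indicator_of_mem hx, extend_of_mem (Or.inr ((hmem x).2 hx)),
            hu.boundary _ ((hmem x).2 hx)]
        · rw [Set.indicator_of_notMem hx, extend, Set.indicator_of_notMem]
          exact fun h => h.elim (hcyl x) fun h => hx ((hmem x).1 h)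
      · refine HasSigmaCompactSuperlevels.congr hzero fun x => ?_
        refine Set.indicator_of_notMem (fun h => h.elim (hcyl x) fun h => ?_) _
        exact h.elim (fun h => hs' h.2.1) fun h => hs' h.2.1
    | succ k ih =>
      intro s hs
      by_cases hs0 : s ≤ 0
      · exact ih s (hs0.trans (by positivity))
      rw [not_le] at hs0
      have hmem : ∀ x, s ≤ T → ((x, s) ∈ boundaryStrip Ω T ε ↔ x ∈ outerStrip Ω ε) := by
        intro x hsT
        simp only [boundaryStrip, Set.mem_union, Set.mem_prod, Set.mem_Icc]
        have h1 : -ε ^ 2 ≤ s := by linarith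
        have h2 : ¬ s ≤ 0 := not_le.2 hs0
        tauto
      have hS : s ≤ T → HasSigmaCompactSuperlevels
          ((outerStrip Ω ε).indicator fun x => F (x, s)) := fun hsT =>
        HasSigmaCompactSuperlevels.indicator_of_continuousOn (isClosed_outerStrip (Ω := Ω) ho)
          (hF.comp (by fun_prop) fun x hx => (hmem x hsT).2 hx)
      have hout : ∀ x, s ≤ T → (x, s) ∉ cylinder Ω T →
          extend Ω T ε u (x, s) = (outerStrip Ω ε).indicator (fun x => F (x, s)) x := by
        intro x hsT hxc
        by_cases hx : x ∈ outerStrip Ω ε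
        · rw [Set.indicator_of_mem hx, extend_of_mem (Or.inr ((hmem x hsT).2 hx)),
            hu.boundary _ ((hmem x hsT).2 hx)]
        · rw [Set.indicator_of_notMem hx, extend, Set.indicator_of_notMem]
          exact fun h => h.elim hxc fun h => hx ((hmem x hsT).1 h)
      -- The slice at `T` is special: it meets `Γ_ε` in the outer strip but misses `Ω_T`.
      rcases lt_trichotomy s T with hsT | rfl | hsT
      · have hprev := ih (s - ε ^ 2) (by push_cast at hs; linarith)
        have hA : HasSigmaCompactSuperlevels fun x =>
            beta n p * ⨍ y in Metric.ball x ε, extend Ω T ε u (y, s - ε ^ 2) :=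
          .of_continuous (continuous_const.mul (continuous_setAverage_ball hε
            (hm.comp (by fun_prop)) fun y => hM _))
        have hG := ((hprev.endpointMean (ε := ε)).iSup
          (bddAbove_endpointMean fun y => hM _)).const_mul (alpha_pos (n := n) hp)
        refine HasSigmaCompactSuperlevels.congr ((hA.add hG).piecewise ho (hS hsT.le)) fun x => ?_
        by_cases hx : x ∈ Ω
        · rw [Set.piecewise_eq_of_mem _ _ _ hx, hu.extend_interior ho hε ⟨hx, hs0, hsT⟩]
          rfl
        · rw [Set.piecewise_eq_of_notMem _ _ _ hx]
          exact hout x hsT.le fun h => hx h.1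
      · refine HasSigmaCompactSuperlevels.congr (hS le_rfl) fun x => ?_
        exact hout x le_rfl fun h => lt_irrefl _ h.2.2
      · refine HasSigmaCompactSuperlevels.congr hzero fun x => ?_
        refine Set.indicator_of_notMem ?_ _
        rintro (h | h | h)
        · exact lt_asymm hsT h.2.2
        · exact absurd h.2.2 (not_le.2 hsT)
        · exact absurd h.2.2 (not_le.2 hs0)
  obtain ⟨k, hk⟩ := exists_nat_ge (s / ε ^ 2)
  exact hind k s ((div_le_iff₀ hε2).1 hk)

theorem SatisfiesDPP.integral_stepLaw_le (hu : SatisfiesDPP Ω T p ε F u) (ho : IsOpen Ω)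
    (hp : 2 < p) (hε : 0 < ε) (hm : Measurable (extend Ω T ε u)) {M : ℝ}
    (hM : ∀ z, |extend Ω T ε u z| ≤ M) {z : State n} (hz : z ∈ cylinder Ω T)
    (σ : Metric.sphere (0 : E n) 1) :
    ∫ y, extend Ω T ε u y ∂(stepLaw p ε z σ) ≤ extend Ω T ε u z := by
  obtain ⟨x, t⟩ := z
  rw [integral_stepLaw hp hε hm hM, hu.extend_interior ho hε hz]
  have hα := alpha_pos (n := n) hp
  gcongr
  exact le_ciSup (bddAbove_endpointMean (ε := ε)
    (g := fun y => extend Ω T ε u (y, t - ε ^ 2)) (fun y => hM _) x) σ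

theorem SatisfiesDPP.exists_near_optimal_direction (hu : SatisfiesDPP Ω T p ε F u)
    (hn : 1 ≤ n) (ho : IsOpen Ω) (hT : 0 < T) (hp : 2 < p) (hε : 0 < ε)
    (hF : ContinuousOn F (boundaryStrip Ω T ε))
    (hm : Measurable (extend Ω T ε u)) {M : ℝ} (hM : ∀ z, |extend Ω T ε u z| ≤ M)
    {δ : ℝ} (hδ : 0 < δ) (s : ℝ) :
    ∃ d : E n → Metric.sphere (0 : E n) 1, Measurable d ∧ ∀ x, (x, s) ∈ cylinder Ω T →
      extend Ω T ε u (x, s) - δ ≤ ∫ y, extend Ω T ε u y ∂(stepLaw p ε (x, s) (d x)) := by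
  have := nonempty_sphere hn
  have hsc := hu.hasSigmaCompactSuperlevels_extend hn ho hT hp hε hF hm hM (s - ε ^ 2)
  obtain ⟨d, hd, hdopt⟩ := exists_measurable_near_maximizer (hsc.endpointMean (ε := ε))
    (bddAbove_endpointMean fun y => hM _) hδ
  refine ⟨d, hd, fun x hx => ?_⟩
  rw [integral_stepLaw hp hε hm hM, hu.extend_interior ho hε hx]
  have hα := alpha_pos (n := n) hp
  have hα1 : alpha n p ≤ 1 := by linarith [alpha_add_beta (n := n) hp, beta_pos (n := n) hp]
  have h1 := mul_le_mul_of_nonneg_left (hdopt x) hα.le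
  simp only [endpointMean] at h1
  -- The error `δ` in the supremum enters with weight `α ≤ 1`.
  nlinarith [mul_le_of_le_one_left hδ.le hα1]

end DPP

/-! ### The law of the game and the stopped process. -/

section Game

variable {n : ℕ} {p ε : ℝ}

instance isProbabilityMeasure_gameLaw (hp : 2 < p) (hε : 0 < ε) (S : Strategy n) (z₀ : State n) :
    IsProbabilityMeasure (gameLaw hp hε S z₀) := by
  have := isMarkovKernel_transition hp hε S
  unfold gameLaw
  infer_instance

/-- The defining property of the Ionescu-Tulcea measure, from which the tower property and the
almost sure step constraints below are derived. -/
theorem gameLaw_map_history_next (hp : 2 < p) (hε : 0 < ε) (S : Strategy n) (z₀ : State n)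
    (k : ℕ) :
    (gameLaw hp hε S z₀).map
        (fun ω => (Preorder.frestrictLe (π := fun _ => State n) k ω, ω (k + 1))) =
      ((gameLaw hp hε S z₀).map (Preorder.frestrictLe (π := fun _ => State n) k)) ⊗ₘ
        (transition p ε S k) := by
  have := isMarkovKernel_transition hp hε S
  unfold gameLaw
  rw [Kernel.traj_map_frestrictLe_apply]
  exact (Kernel.partialTraj_compProd_eq_map_traj (Nat.zero_le k)).symm

theorem integral_gameLaw_history_next (hp : 2 < p) (hε : 0 < ε) (S : Strategy n) (z₀ : State n)
    (k : ℕ) {f : (Finset.Iic k → State n) × State n → ℝ} (hf : Measurable f) {M : ℝ}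
    (hM : ∀ q, |f q| ≤ M) :
    ∫ ω, f (Preorder.frestrictLe (π := fun _ => State n) k ω, ω (k + 1)) ∂(gameLaw hp hε S z₀) =
      ∫ ω, ∫ y, f (Preorder.frestrictLe (π := fun _ => State n) k ω, y)
        ∂(stepLaw p ε (ω k) (S.next k (Preorder.frestrictLe (π := fun _ => State n) k ω)))
          ∂(gameLaw hp hε S z₀) := by
  have := isMarkovKernel_transition hp hε S
  have hr : Measurable (Preorder.frestrictLe (π := fun _ => State n) k) := by fun_prop
  have := Measure.isProbabilityMeasure_map (μ := gameLaw hp hε S z₀) hr.aemeasurable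
  have h1 := integral_map (μ := gameLaw hp hε S z₀)
    (φ := fun ω => (Preorder.frestrictLe (π := fun _ => State n) k ω, ω (k + 1)))
    (f := f) (by fun_prop) hf.aestronglyMeasurable
  rw [← h1, gameLaw_map_history_next, Measure.integral_compProd
    (Integrable.of_bound hf.aestronglyMeasurable M (.of_forall hM)), integral_map hr.aemeasurable]
  · rfl
  · exact (hf.stronglyMeasurable.integral_kernel_prod_right'
      (κ := transition p ε S k)).aestronglyMeasurable

theorem ae_gameLaw_history_next (hp : 2 < p) (hε : 0 < ε) (S : Strategy n) (z₀ : State n)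
    (k : ℕ) {P : (Finset.Iic k → State n) × State n → Prop} (hP : MeasurableSet {q | P q})
    (h : ∀ h : Finset.Iic k → State n,
      ∀ᵐ y ∂(stepLaw p ε (h ⟨k, Finset.mem_Iic.2 le_rfl⟩) (S.next k h)), P (h, y)) :
    ∀ᵐ ω ∂(gameLaw hp hε S z₀),
      P (Preorder.frestrictLe (π := fun _ => State n) k ω, ω (k + 1)) := by
  have := isMarkovKernel_transition hp hε S
  have hr : Measurable (Preorder.frestrictLe (π := fun _ => State n) k) := by fun_prop
  have := Measure.isProbabilityMeasure_map (μ := gameLaw hp hε S z₀) hr.aemeasurable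
  refine (ae_map_iff (μ := gameLaw hp hε S z₀)
    (f := fun ω => (Preorder.frestrictLe (π := fun _ => State n) k ω, ω (k + 1)))
    (by fun_prop) hP).1 ?_
  rw [gameLaw_map_history_next, Measure.ae_compProd_iff hP]
  exact .of_forall h

theorem ae_stepLaw (z : State n) (σ : Metric.sphere (0 : E n) 1) (hε : 0 < ε) :
    ∀ᵐ y ∂(stepLaw p ε z (σ : E n)), dist y.1 z.1 ≤ ε ∧ y.2 = z.2 - ε ^ 2 := by
  have hm : MeasurableSet {y : State n | dist y.1 z.1 ≤ ε ∧ y.2 = z.2 - ε ^ 2} := by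
    have h1 : MeasurableSet {y : State n | dist y.1 z.1 ≤ ε} :=
      measurableSet_le (by fun_prop) (by fun_prop)
    have h2 : MeasurableSet {y : State n | y.2 = z.2 - ε ^ 2} :=
      measurableSet_eq_fun (by fun_prop) (by fun_prop)
    exact h1.inter h2
  unfold stepLaw
  rw [ae_add_measure_iff, ae_add_measure_iff]
  refine ⟨⟨Measure.ae_smul_measure ?_ _, Measure.ae_smul_measure ?_ _⟩,
    Measure.ae_smul_measure ?_ _⟩
  · rw [ae_map_iff (by fun_prop) hm]
    filter_upwards [ae_cond_mem (μ := volume)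
      (Metric.isOpen_ball (x := z.1) (ε := ε)).measurableSet] with y hy
    exact ⟨(Metric.mem_ball.1 hy).le, rfl⟩
  · rw [ae_dirac_iff hm]
    exact ⟨dist_add_smul_le hε _ σ, rfl⟩
  · rw [ae_dirac_iff hm]
    exact ⟨dist_sub_smul_le hε _ σ, rfl⟩

theorem ae_gameLaw_step (hp : 2 < p) (hε : 0 < ε) (S : Strategy n) (z₀ : State n) :
    ∀ᵐ ω ∂(gameLaw hp hε S z₀), ∀ k,
      dist (ω (k + 1)).1 (ω k).1 ≤ ε ∧ (ω (k + 1)).2 = (ω k).2 - ε ^ 2 := by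
  refine ae_all_iff.2 fun k => ?_
  refine ae_gameLaw_history_next hp hε S z₀ k
    (P := fun q => dist q.2.1 (q.1 ⟨k, Finset.mem_Iic.2 le_rfl⟩).1 ≤ ε ∧
      q.2.2 = (q.1 ⟨k, Finset.mem_Iic.2 le_rfl⟩).2 - ε ^ 2) ?_ fun h => ae_stepLaw _ _ hε
  have h1 : MeasurableSet {q : (Finset.Iic k → State n) × State n |
      dist q.2.1 (q.1 ⟨k, Finset.mem_Iic.2 le_rfl⟩).1 ≤ ε} :=
    measurableSet_le (by fun_prop) (by fun_prop)
  have h2 : MeasurableSet {q : (Finset.Iic k → State n) × State n |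
      q.2.2 = (q.1 ⟨k, Finset.mem_Iic.2 le_rfl⟩).2 - ε ^ 2} :=
    measurableSet_eq_fun (by fun_prop) (by fun_prop)
  exact h1.inter h2

theorem ae_gameLaw_start (hp : 2 < p) (hε : 0 < ε) (S : Strategy n) (z₀ : State n) :
    ∀ᵐ ω ∂(gameLaw hp hε S z₀), ω 0 = z₀ := by
  have := isMarkovKernel_transition hp hε S
  have hr : Measurable (Preorder.frestrictLe (π := fun _ => State n) 0) := by fun_prop
  have hm : MeasurableSet {h : Finset.Iic 0 → State n | h ⟨0, Finset.mem_Iic.2 le_rfl⟩ = z₀} :=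
    measurableSet_eq_fun (by fun_prop) (by fun_prop)
  refine (ae_map_iff (μ := gameLaw hp hε S z₀) hr.aemeasurable hm).1 ?_
  unfold gameLaw
  rw [Kernel.traj_map_frestrictLe_apply, Kernel.partialTraj_self, Kernel.id_apply, ae_dirac_iff hm]

theorem time_eq_of_step {z₀ : State n} {ω : ℕ → State n} (h0 : ω 0 = z₀)
    (hstep : ∀ k, (ω (k + 1)).2 = (ω k).2 - ε ^ 2) (k : ℕ) : (ω k).2 = z₀.2 - k * ε ^ 2 := by
  induction k with
  | zero => simp [h0]
  | succ k ih =>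
    rw [hstep, ih]
    push_cast
    ring

open Classical in
/-- The value of `v` along `ω`, stopped at the first exit from `C`. -/
noncomputable def stoppedAlong (C : Set (State n)) (v : State n → ℝ) :
    ℕ → (ℕ → State n) → ℝ
  | 0, ω => v (ω 0)
  | k + 1, ω => if ∀ j ≤ k, ω j ∈ C then v (ω (k + 1)) else stoppedAlong C v k ω

variable {C : Set (State n)} {v : State n → ℝ}

theorem stoppedAlong_of_forall_mem {k : ℕ} {ω : ℕ → State n} (h : ∀ j < k, ω j ∈ C) :
    stoppedAlong C v k ω = v (ω k) := by
  cases k with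
  | zero => rfl
  | succ k => exact if_pos fun j hj => h j (Nat.lt_succ_of_le hj)

theorem stoppedAlong_of_exit {m k : ℕ} {ω : ℕ → State n} (hm : ω m ∉ C)
    (h : ∀ j < m, ω j ∈ C) (hmk : m ≤ k) : stoppedAlong C v k ω = v (ω m) := by
  induction k, hmk using Nat.le_induction with
  | base => exact stoppedAlong_of_forall_mem h
  | succ k hk ih =>
    rw [stoppedAlong, if_neg fun h' => hm (h' m hk), ih]

theorem measurable_stoppedAlong (hC : MeasurableSet C) (hv : Measurable v) (k : ℕ) :
    Measurable (stoppedAlong C v k) := by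
  induction k with
  | zero => exact hv.comp (measurable_pi_apply 0)
  | succ k ih =>
    refine Measurable.ite ?_ (hv.comp (measurable_pi_apply (k + 1))) ih
    have : {ω : ℕ → State n | ∀ j ≤ k, ω j ∈ C} = ⋂ j, ⋂ _ : j ≤ k, (fun ω => ω j) ⁻¹' C := by
      ext ω
      simp
    rw [this]
    exact .iInter fun j => .iInter fun _ => measurable_pi_apply j hC

theorem abs_stoppedAlong_le {M : ℝ} (hM : ∀ z, |v z| ≤ M) (k : ℕ) (ω : ℕ → State n) :
    |stoppedAlong C v k ω| ≤ M := by
  induction k with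
  | zero => exact hM _
  | succ k ih =>
    rw [stoppedAlong]
    split_ifs
    exacts [hM _, ih]

open Classical in
/-- The conditional expected increment of `stoppedAlong C v` between the times `k` and `k + 1`. -/
noncomputable def expectedGain (p ε : ℝ) (C : Set (State n)) (v : State n → ℝ) (S : Strategy n)
    (k : ℕ) (ω : ℕ → State n) : ℝ :=
  if ∀ j ≤ k, ω j ∈ C then
    (∫ y, v y ∂(stepLaw p ε (ω k)
      (S.next k (Preorder.frestrictLe (π := fun _ => State n) k ω)))) - v (ω k)
  else 0

/-- The increment of the stopped process is a bounded Borel function of the history and the next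
state, so conditioning on the history replaces it by its integral against `stepLaw`. -/
theorem integral_stoppedAlong_succ (hp : 2 < p) (hε : 0 < ε) (S : Strategy n) (z₀ : State n)
    (hC : MeasurableSet C) (hv : Measurable v) {M : ℝ} (hM : ∀ z, |v z| ≤ M) (k : ℕ) :
    Integrable (expectedGain p ε C v S k) (gameLaw hp hε S z₀) ∧
    ∫ ω, stoppedAlong C v (k + 1) ω ∂(gameLaw hp hε S z₀) =
      ∫ ω, stoppedAlong C v k ω ∂(gameLaw hp hε S z₀) +
        ∫ ω, expectedGain p ε C v S k ω ∂(gameLaw hp hε S z₀) := by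
  classical
  let f : (Finset.Iic k → State n) × State n → ℝ := fun q =>
    if ∀ j, q.1 j ∈ C then v q.2 - v (q.1 ⟨k, Finset.mem_Iic.2 le_rfl⟩) else 0
  have hf : Measurable f := by
    refine Measurable.ite ?_ (by fun_prop) measurable_const
    have : {q : (Finset.Iic k → State n) × State n | ∀ j, q.1 j ∈ C} =
        ⋂ j, (fun q => q.1 j) ⁻¹' C := by
      ext q
      simp
    rw [this]
    exact .iInter fun j => (show Measurable fun q : (Finset.Iic k → State n) × State n => q.1 j by
      fun_prop) hC
  have hfM : ∀ q, |f q| ≤ 2 * M := by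
    intro q
    have h1 := abs_le.1 (hM q.2)
    have h2 := abs_le.1 (hM (q.1 ⟨k, Finset.mem_Iic.2 le_rfl⟩))
    simp only [f]
    split_ifs
    · exact abs_le.2 ⟨by linarith [h1.1, h2.2], by linarith [h1.2, h2.1]⟩
    · rw [abs_zero]
      linarith [h1.1, h1.2]
  have hiff : ∀ ω : ℕ → State n,
      (∀ j, Preorder.frestrictLe (π := fun _ => State n) k ω j ∈ C) ↔ ∀ j ≤ k, ω j ∈ C :=
    fun ω => ⟨fun h j hj => h ⟨j, Finset.mem_Iic.2 hj⟩, fun h j => h j (Finset.mem_Iic.1 j.2)⟩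
  have hsucc : ∀ ω, stoppedAlong C v (k + 1) ω = stoppedAlong C v k ω +
      f (Preorder.frestrictLe (π := fun _ => State n) k ω, ω (k + 1)) := by
    intro ω
    simp only [f, hiff, stoppedAlong]
    split_ifs with h
    · rw [stoppedAlong_of_forall_mem fun j hj => h j hj.le]
      simp
    · simp
  have hinner : ∀ ω : ℕ → State n,
      ∫ y, f (Preorder.frestrictLe (π := fun _ => State n) k ω, y)
        ∂(stepLaw p ε (ω k) (S.next k (Preorder.frestrictLe (π := fun _ => State n) k ω))) =
      expectedGain p ε C v S k ω := by
    intro ω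
    have := isProbabilityMeasure_stepLaw hp hε (ω k)
      (S.next k (Preorder.frestrictLe (π := fun _ => State n) k ω))
    simp only [f, hiff, expectedGain]
    split_ifs
    · rw [integral_sub (Integrable.of_bound hv.aestronglyMeasurable M (.of_forall hM))
        (integrable_const _)]
      simp
    · simp
  have hgm : Measurable fun ω : ℕ → State n => f
      (Preorder.frestrictLe (π := fun _ => State n) k ω, ω (k + 1)) := hf.comp (by fun_prop)
  have hV : Integrable (stoppedAlong C v k) (gameLaw hp hε S z₀) :=
    Integrable.of_bound (measurable_stoppedAlong hC hv k).aestronglyMeasurable M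
      (.of_forall (abs_stoppedAlong_le hM k))
  let κ := transition p ε S k
  let r := Preorder.frestrictLe (π := fun _ => State n) k
  have : IsMarkovKernel κ := isMarkovKernel_transition hp hε S k
  have hI : Measurable fun h : Finset.Iic k → State n => ∫ y, f (h, y) ∂(κ h) :=
    (hf.stronglyMeasurable.integral_kernel_prod_right' (κ := κ)).measurable
  have hr : Measurable r := Preorder.measurable_frestrictLe (X := fun _ => State n) k
  have hIr : Integrable (fun ω => ∫ y, f (r ω, y) ∂(κ (r ω))) (gameLaw hp hε S z₀) := by
    refine Integrable.of_bound (hI.comp hr).aestronglyMeasurable (2 * M) (.of_forall fun ω => ?_)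
    have h := norm_integral_le_of_norm_le_const (μ := κ (r ω)) (f := fun y => f (r ω, y))
      (C := 2 * M) (.of_forall fun y => hfM _)
    rwa [probReal_univ, mul_one] at h
  have hgain : expectedGain p ε C v S k = fun ω => ∫ y, f (r ω, y) ∂(κ (r ω)) :=
    funext fun ω => (hinner ω).symm
  refine ⟨hgain ▸ hIr, ?_⟩
  simp only [hsucc]
  rw [integral_add hV (Integrable.of_bound hgm.aestronglyMeasurable (2 * M)
      (.of_forall fun ω => hfM _)), integral_gameLaw_history_next hp hε S z₀ k hf hfM, hgain]
  rfl

theorem integral_stoppedAlong_le (hp : 2 < p) (hε : 0 < ε) (S : Strategy n) (z₀ : State n)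
    (hC : MeasurableSet C) (hv : Measurable v) {M : ℝ} (hM : ∀ z, |v z| ≤ M)
    (hsuper : ∀ z ∈ C, ∀ σ : Metric.sphere (0 : E n) 1, ∫ y, v y ∂(stepLaw p ε z σ) ≤ v z)
    (k : ℕ) : ∫ ω, stoppedAlong C v k ω ∂(gameLaw hp hε S z₀) ≤ v z₀ := by
  induction k with
  | zero =>
    refine (integral_congr_ae (g := fun _ => v z₀) ?_).trans (by simp) |>.le
    filter_upwards [ae_gameLaw_start hp hε S z₀] with ω hω
    simp only [stoppedAlong, hω]
  | succ k ih =>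
    rw [(integral_stoppedAlong_succ hp hε S z₀ hC hv hM k).2]
    refine (add_le_of_nonpos_right (integral_nonpos fun ω => ?_)).trans ih
    unfold expectedGain
    split_ifs with h
    · exact sub_nonpos.2 (hsuper _ (h k le_rfl) _)
    · exact le_rfl

/-- Each move costs at most `δ`. Near-optimality is required only at the times `t₀ - k ε²`, the only
ones reached almost surely; thus directions may be selected separately on each time slice, without
joint measurability in space and time. -/
theorem le_integral_stoppedAlong (hp : 2 < p) (hε : 0 < ε) (S : Strategy n) (z₀ : State n)
    (hC : MeasurableSet C) (hv : Measurable v) {M : ℝ} (hM : ∀ z, |v z| ≤ M) {δ : ℝ} (hδ : 0 ≤ δ)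
    (hsub : ∀ (k : ℕ) (x : E n), (x, z₀.2 - k * ε ^ 2) ∈ C →
      ∀ h : Finset.Iic k → State n, (h ⟨k, Finset.mem_Iic.2 le_rfl⟩).1 = x →
      v (x, z₀.2 - k * ε ^ 2) - δ ≤
        ∫ y, v y ∂(stepLaw p ε (x, z₀.2 - k * ε ^ 2) (S.next k h)))
    (k : ℕ) : v z₀ - k * δ ≤ ∫ ω, stoppedAlong C v k ω ∂(gameLaw hp hε S z₀) := by
  induction k with
  | zero =>
    refine ((integral_congr_ae (g := fun _ => v z₀) ?_).trans (by simp)).ge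
    filter_upwards [ae_gameLaw_start hp hε S z₀] with ω hω
    simp only [stoppedAlong, hω]
  | succ k ih =>
    obtain ⟨hint, heq⟩ := integral_stoppedAlong_succ hp hε S z₀ hC hv hM k
    have hgain : -δ ≤ ∫ ω, expectedGain p ε C v S k ω ∂(gameLaw hp hε S z₀) := by
      have : -δ = ∫ _, -δ ∂(gameLaw hp hε S z₀) := by simp
      rw [this]
      refine integral_mono_ae (integrable_const _) hint ?_
      filter_upwards [ae_gameLaw_start hp hε S z₀, ae_gameLaw_step hp hε S z₀] with ω h0 hstep
      have ht := time_eq_of_step h0 (fun k => (hstep k).2) k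
      unfold expectedGain
      split_ifs with h
      · have hz : ω k = ((ω k).1, z₀.2 - k * ε ^ 2) := Prod.ext rfl ht
        have := hsub k (ω k).1 (hz ▸ h k le_rfl)
          (Preorder.frestrictLe (π := fun _ => State n) k ω) rfl
        rw [← hz] at this
        linarith
      · linarith
    rw [heq]
    push_cast
    linarith

end Game

/-! ### The stopped process ends at the payoff. -/

section Value

variable {n : ℕ} {Ω : Set (E n)} {T p ε : ℝ} {F u : State n → ℝ}

theorem stoppedAlong_eq_payoff (hu : SatisfiesDPP Ω T p ε F u) (ho : IsOpen Ω)
    {z₀ : State n} (hz₀ : z₀ ∈ domain Ω T ε) {N : ℕ} (hN : z₀.2 ≤ N * ε ^ 2)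
    {ω : ℕ → State n} (h0 : ω 0 = z₀)
    (hstep : ∀ k, dist (ω (k + 1)).1 (ω k).1 ≤ ε ∧ (ω (k + 1)).2 = (ω k).2 - ε ^ 2) :
    stoppedAlong (cylinder Ω T) (extend Ω T ε u) N ω = F (ω (hitIndex Ω T ε ω)) := by
  classical
  -- After `N` moves the time is at most `0`.
  have hNexit : ω N ∉ cylinder Ω T := fun h => by
    have h1 := h.2.1
    rw [time_eq_of_step h0 (fun k => (hstep k).2) N] at h1
    linarith
  have hex : ∃ k, ω k ∉ cylinder Ω T := ⟨N, hNexit⟩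
  have hm := Nat.find_spec hex
  have hlt : ∀ j < Nat.find hex, ω j ∈ cylinder Ω T := fun j hj => not_not.1 (Nat.find_min hex hj)
  have hmN : Nat.find hex ≤ N := Nat.find_min' hex hNexit
  generalize Nat.find hex = m at hm hlt hmN
  have hmD : ω m ∈ domain Ω T ε := by
    cases m with
    | zero => rwa [h0]
    | succ j =>
      have := mem_domain_of_dist_le ho (x := (ω j).1) (t := (ω j).2) (hlt j (Nat.lt_succ_self j))
        (hstep j).1
      rwa [← (hstep j).2] at this
  have hmΓ : ω m ∈ boundaryStrip Ω T ε := hmD.resolve_left hm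
  -- First exit from `Ω_T` and first entry into `Γ_ε` coincide: the two sets are disjoint and the
  -- exit point stays in their union.
  have hhit : hitIndex Ω T ε ω = m := by
    refine le_antisymm (Nat.sInf_le hmΓ) ?_
    refine le_csInf ⟨m, hmΓ⟩ fun k hk => ?_
    by_contra! hkm
    exact notMem_boundaryStrip (hlt k hkm) hk
  rw [stoppedAlong_of_exit hm hlt hmN, hhit, extend_of_mem hmD, hu.boundary _ hmΓ]

theorem expectedPayoff_eq_integral_stoppedAlong (hu : SatisfiesDPP Ω T p ε F u) (ho : IsOpen Ω)
    (hp : 2 < p) (hε : 0 < ε) {z₀ : State n} (hz₀ : z₀ ∈ domain Ω T ε) {N : ℕ}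
    (hN : z₀.2 ≤ N * ε ^ 2) (S : Strategy n) :
    expectedPayoff Ω T hp hε F S z₀ =
      ∫ ω, stoppedAlong (cylinder Ω T) (extend Ω T ε u) N ω ∂(gameLaw hp hε S z₀) := by
  refine integral_congr_ae ?_
  filter_upwards [ae_gameLaw_start hp hε S z₀, ae_gameLaw_step hp hε S z₀] with ω h0 hstep
  exact (stoppedAlong_eq_payoff hu ho hz₀ hN h0 hstep).symm

end Value

end DominativeGame

/-! ### Comparison of the DPP solution with the game value. -/

theorem lemma3p4 {n : ℕ} (hn : 1 ≤ n) {Ω : Set (DominativeGame.E n)}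
    (hΩ_open : IsOpen Ω) (hΩ_conn : IsConnected Ω) (hΩ_bdd : Bornology.IsBounded Ω)
    {T p ε : ℝ} (hT : 0 < T) (hp : 2 < p) (hε : 0 < ε)
    {F : DominativeGame.State n → ℝ}
    (hF : ContinuousOn F (DominativeGame.boundaryStrip Ω T ε))
    {u : DominativeGame.State n → ℝ}
    (hu : DominativeGame.SatisfiesDPP Ω T p ε F u) :
    ∀ z ∈ DominativeGame.cylinder Ω T ∪ DominativeGame.boundaryStrip Ω T ε,
      u z = DominativeGame.gameValue Ω T hp hε F z := by
  open DominativeGame in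
  intro z hz
  have hΩ := hΩ_conn.nonempty
  obtain ⟨M, hM'⟩ := hu.exists_bound hn hΩ_open hΩ hΩ_bdd hT hp hε hF
  have hM := abs_extend_le hΩ hT hM'
  have hC : MeasurableSet (cylinder Ω T) := (isOpen_cylinder hΩ_open).measurableSet
  have hm := hu.measurable_extend
    (hC.union (isCompact_boundaryStrip hn hΩ_open hΩ hΩ_bdd hT hε).isClosed.measurableSet)
  obtain ⟨N, hN⟩ := exists_nat_ge (z.2 / ε ^ 2)
  rw [div_le_iff₀ (by positivity)] at hN
  have hpay := expectedPayoff_eq_integral_stoppedAlong hu hΩ_open hp hε hz hN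
  have hupper : ∀ S : Strategy n, expectedPayoff Ω T hp hε F S z ≤ u z := fun S => by
    rw [hpay, ← extend_of_mem (u := u) hz]
    exact integral_stoppedAlong_le hp hε S z hC hm hM
      (fun z hz σ => hu.integral_stepLaw_le hΩ_open hp hε hm hM hz σ) N
  have hlower : ∀ δ > 0, ∃ S : Strategy n, u z - N * δ ≤ expectedPayoff Ω T hp hε F S z := by
    intro δ hδ
    choose d hd hdopt using fun k : ℕ => hu.exists_near_optimal_direction hn hΩ_open hT hp hε hF
      hm hM hδ (z.2 - k * ε ^ 2)
    -- The strategy uses only the move number and the current position. It is adapted to the fixed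
    -- starting time, which is harmless because the supremum is taken for each starting point
    -- separately.
    refine ⟨⟨fun k q => d k (q.2 ⟨k, Finset.mem_Iic.2 le_rfl⟩), fun k => (hd k).comp (by fun_prop)⟩,
      ?_⟩
    rw [hpay, ← extend_of_mem (u := u) hz]
    refine le_integral_stoppedAlong hp hε _ z hC hm hM hδ.le (fun k x hx h hhx => ?_) N
    simp only [Strategy.next, hhx]
    exact hdopt k x hx
  -- The set of strategies must be nonempty for the bound on each payoff to bound the supremum.
  obtain ⟨S₀, -⟩ := hlower 1 one_pos
  have : Nonempty (Strategy n) := ⟨S₀⟩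
  have hbdd : BddAbove (Set.range fun S : Strategy n => expectedPayoff Ω T hp hε F S z) :=
    ⟨u z, by rintro _ ⟨S, rfl⟩; exact hupper S⟩
  refine le_antisymm (le_of_forall_pos_le_add fun η hη => ?_) (ciSup_le hupper)
  -- `N + 1` rather than `N`, since `N` may be `0` when the starting time is nonpositive.
  obtain ⟨S, hS⟩ := hlower (η / (N + 1)) (by positivity)
  have h1 : N * (η / (N + 1)) ≤ η := by
    rw [mul_div_assoc', div_le_iff₀ (by positivity)]
    nlinarith
  have h2 : expectedPayoff Ω T hp hε F S z ≤ gameValue Ω T hp hε F z := le_ciSup hbdd S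
  linarith
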